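/- Let $q>2$ be a prime power and regard $\mathbb F_{q^3}^3$ as a 9-dimensional vector space over $\mathbb F_q$, so that its $\mathbb F_q$-subspaces of vector dimension $d+1$ are the $d$-spaces of $\mathrm{PG}(8,q)$. A point $\bar P$ of $\mathrm{PG}(2,q^3)$ (a 1-dimensional $\mathbb F_{q^3}$-subspace) is then a plane $[\![P]\!]$ of $\mathrm{PG}(8,q)$, and a line $\bar\ell$ of $\mathrm{PG}(2,q^3)$ is a 5-space $[\![\ell]\!]$ of $\mathrm{PG}(8,q)$. The planes $[\![P]\!]$ partition the points of $\mathrm{PG}(8,q)$. Let $\phi$ be a collineation of $\mathrm{PG}(2,q^3)$ of order 3 which fixes pointwise an $\mathbb F_q$-plane (an image of $\mathrm{PG}(2,q)$ under $\mathrm{PGL}(3,q^3)$), and let $\sigma\in\mathrm{PGL}(9,q)$ be a projectivity of $\mathrm{PG}(8,q)$ inducing $\phi$, that is, $[\![P]\!]^\sigma=[\![P^\phi]\!]$ for every point $\bar P$ of $\mathrm{PG}(2,q^3)$. A point $\bar P$ of $\mathrm{PG}(2,q^3)$ has Type I, II or III if its orbit under $\phi$ is one point, three distinct collinear points, or three non-collinear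 points, respectively; a line has Type I if it is fixed by $\phi$. An $\mathbb S_{\mathrm I}$-plane is a plane $[\![P]\!]$ with $\bar P$ of Type I, and an $\mathbb H_{\mathrm I}$-5-space is a 5-space $[\![\ell]\!]$ with $\bar\ell$ of Type I. For $Y\in\{\mathrm{II},\mathrm{III}\}$, a $Y_{\therefore}$-point is a point $X$ of $\mathrm{PG}(8,q)$ that lies in $[\![P]\!]$ for some $\bar P$ of Type $Y$ and such that $X,X^\sigma,X^{\sigma^2}$ are not collinear. A hwise-fixed 5-space is a 5-space of $\mathrm{PG}(8,q)$ such that every hyperplane of $\mathrm{PG}(8,q)$ containing it is fixed by $\sigma$. Theorem 17. Every plane $\pi$ of $\mathrm{PG}(8,q)$ that is fixed by $\sigma$ is of exactly one of the following five types: (1) $\pi$ is fixed pointwise by $\sigma$; (2) $\pi$ is an $\mathbb S_{\mathrm I}$-plane; (3) $\pi$ contains at least one $\mathrm{II}_{\therefore}$-point (a fixed-II-plane); (4) $\pi$ contains at least one $\mathrm{III}_{\therefore}$-point (a fixed-III-plane); (5) $\pi$ is contained in a hwise-fixed 5-space and is not fixed pointwise by $\sigma$ (an h-plane). Moreover, in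 case (3), $\pi$ lies in a unique $\mathbb H_{\mathrm I}$-5-space. -/

import Mathlib

namespace FieldReduction

/-- Three points of the projective space of `W` lie on a common (projective) line. -/
def Collinear3 {k W : Type*} [Field k] [AddCommGroup W] [Module k W]
    (P Q R : Projectivization k W) : Prop :=
  ∃ l : Submodule k W, Module.finrank k l = 2 ∧
    P.submodule ≤ l ∧ Q.submodule ≤ l ∧ R.submodule ≤ l

section PlaneOverK

variable {K : Type*} [Field K]

/-- A permutation of the points of `PG(2, K)` is a collineation if it preserves collinearity
in both directions. -/
def IsCollineation (φ : Equiv.Perm (Projectivization K (Fin 3 → K))) : Prop :=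
  ∀ P Q R, Collinear3 (φ P) (φ Q) (φ R) ↔ Collinear3 P Q R

/-- The set `S` of points of `PG(2, K)` is an `F`-plane: the image of `PG(2, F)` under a
projectivity of `PG(2, K)`, i.e. the points spanned by the nonzero `F`-linear combinations of some
`K`-basis. -/
def IsSubplane (F : Type*) [Field F] [Algebra F K]
    (S : Set (Projectivization K (Fin 3 → K))) : Prop :=
  ∃ b : Module.Basis (Fin 3) K (Fin 3 → K),
    S = {P | ∃ a : Fin 3 → F, a ≠ 0 ∧ P.submodule = Submodule.span K {∑ i, a i • b i}}

variable (φ : Equiv.Perm (Projectivization K (Fin 3 → K)))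

/-- A point of Type I: its orbit under `φ` is one point. -/
def IsTypeIPoint (P : Projectivization K (Fin 3 → K)) : Prop := φ P = P

/-- A point of Type II: its orbit under `φ` (of order 3) consists of three collinear points. -/
def IsTypeIIPoint (P : Projectivization K (Fin 3 → K)) : Prop :=
  P ≠ φ P ∧ φ P ≠ φ (φ P) ∧ P ≠ φ (φ P) ∧ Collinear3 P (φ P) (φ (φ P))

/-- A point of Type III: its orbit under `φ` (of order 3) consists of three non-collinear points. -/
def IsTypeIIIPoint (P : Projectivization K (Fin 3 → K)) : Prop :=
  ¬ Collinear3 P (φ P) (φ (φ P))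

/-- A line of Type I of `PG(2, K)`: a line mapped to itself by `φ`. -/
def IsTypeILine (l : Submodule K (Fin 3 → K)) : Prop :=
  Module.finrank K l = 2 ∧ ∀ P : Projectivization K (Fin 3 → K),
    (φ P).submodule ≤ l ↔ P.submodule ≤ l

end PlaneOverK

section SpaceOverF

/-! `PG(8, F)` is the projective space of `K ^ 3`, regarded as a vector space of dimension `9` over
`F`. A subspace of projective dimension `d` is an `F`-submodule of `finrank` equal to `d + 1`. -/

variable {F K : Type*} [Field F] [Field K] [Algebra F K]

/-- The spread plane of `PG(8, F)` corresponding to a point of `PG(2, K)`. -/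
def spreadPlane (F : Type*) {K : Type*} [Field F] [Field K] [Algebra F K]
    (P : Projectivization K (Fin 3 → K)) : Submodule F (Fin 3 → K) :=
  P.submodule.restrictScalars F

/-- The projectivity `σ` of `PG(8, F)` (given by a linear representative) induces the collineation
`φ` of `PG(2, K)`: it maps the spread plane of each point `P` to the spread plane of `φ P`. -/
def Induces (σ : (Fin 3 → K) ≃ₗ[F] (Fin 3 → K))
    (φ : Equiv.Perm (Projectivization K (Fin 3 → K))) : Prop :=
  ∀ P, (spreadPlane F P).map σ.toLinearMap = spreadPlane F (φ P)

/-- The action of `σ` on the points of `PG(8, F)`. -/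
def act (σ : (Fin 3 → K) ≃ₗ[F] (Fin 3 → K)) (X : Projectivization F (Fin 3 → K)) :
    Projectivization F (Fin 3 → K) :=
  Projectivization.map σ.toLinearMap σ.injective X

variable (φ : Equiv.Perm (Projectivization K (Fin 3 → K)))
variable (σ : (Fin 3 → K) ≃ₗ[F] (Fin 3 → K))

/-- The point `X` and its images under `σ` and `σ ^ 2` form a triangle. -/
def IsTriangleOrbit (X : Projectivization F (Fin 3 → K)) : Prop :=
  ¬ Collinear3 X (act σ X) (act σ (act σ X))

/-- A `II.:`-point: it lies in the spread plane of a Type II point, and its orbit under `σ` is a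
triangle. -/
def IsIITriPoint (X : Projectivization F (Fin 3 → K)) : Prop :=
  (∃ P, IsTypeIIPoint φ P ∧ X.submodule ≤ spreadPlane F P) ∧ IsTriangleOrbit σ X

/-- A `III.:`-point: it lies in the spread plane of a Type III point, and its orbit under `σ` is a
triangle. -/
def IsIIITriPoint (X : Projectivization F (Fin 3 → K)) : Prop :=
  (∃ P, IsTypeIIIPoint φ P ∧ X.submodule ≤ spreadPlane F P) ∧ IsTriangleOrbit σ X

/-- An `ℍ_I`-5-space: the 5-space of `PG(8, F)` corresponding to a Type I line of `PG(2, K)`. -/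
def IsHISpace (T : Submodule F (Fin 3 → K)) : Prop :=
  ∃ l : Submodule K (Fin 3 → K), IsTypeILine φ l ∧ T = l.restrictScalars F

/-- A 5-space such that every hyperplane of `PG(8, F)` containing it is fixed by `σ`. -/
def IsHwiseFixedSpace (U : Submodule F (Fin 3 → K)) : Prop :=
  Module.finrank F U = 6 ∧
    ∀ H : Submodule F (Fin 3 → K), Module.finrank F H = 8 → U ≤ H → H.map σ.toLinearMap = H

/-- A plane of `PG(8, F)` fixed (as a set of points) by `σ`. -/
def IsFixedPlane (π : Submodule F (Fin 3 → K)) : Prop :=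
  Module.finrank F π = 3 ∧ π.map σ.toLinearMap = π

/-- Every point of `π` is fixed by `σ`. -/
def IsPtwiseFixed (π : Submodule F (Fin 3 → K)) : Prop :=
  ∀ X : Projectivization F (Fin 3 → K), X.submodule ≤ π → act σ X = X

/-- An `𝕊_I`-plane: the spread plane of a Type I point. -/
def IsSIPlane (π : Submodule F (Fin 3 → K)) : Prop :=
  ∃ P, IsTypeIPoint φ P ∧ π = spreadPlane F P

/-- `π` contains a `II.:`-point. -/
def ContainsIITriPoint (π : Submodule F (Fin 3 → K)) : Prop :=
  ∃ X, IsIITriPoint φ σ X ∧ X.submodule ≤ π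

/-- `π` contains a `III.:`-point. -/
def ContainsIIITriPoint (π : Submodule F (Fin 3 → K)) : Prop :=
  ∃ X, IsIIITriPoint φ σ X ∧ X.submodule ≤ π

/-- `π` lies in a hyperplanewise fixed 5-space and is not fixed pointwise. -/
def IsHPlane (π : Submodule F (Fin 3 → K)) : Prop :=
  (∃ U, IsHwiseFixedSpace σ U ∧ π ≤ U) ∧ ¬ IsPtwiseFixed σ π

end SpaceOverF

/-- Names of the five types of fixed planes. -/
inductive PlaneType
  | ptwiseFixed
  | sI
  | fixedII
  | fixedIII
  | h

/-- The fixed plane `π` is of type `t`. -/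
def HasType {F K : Type*} [Field F] [Field K] [Algebra F K]
    (φ : Equiv.Perm (Projectivization K (Fin 3 → K)))
    (σ : (Fin 3 → K) ≃ₗ[F] (Fin 3 → K)) (π : Submodule F (Fin 3 → K)) : PlaneType → Prop
  | .ptwiseFixed => IsPtwiseFixed σ π
  | .sI => IsSIPlane φ π
  | .fixedII => ContainsIITriPoint φ σ π
  | .fixedIII => ContainsIIITriPoint φ σ π
  | .h => IsHPlane σ π

end FieldReduction

namespace FieldReduction

open Module

/-! ### Linear algebra over an arbitrary field: cyclic vectors, hyperplanes and duality. -/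

section LinearAlgebra

variable {k V : Type*} [Field k] [AddCommGroup V] [Module k V]

/-! In a `K`-basis defining the pointwise fixed `F`-plane, `σ` acts on every coordinate by one map
`y ↦ c * τ y`, with `τ` a nontrivial `F`-automorphism of `K` (`Induces.exists_semilinear`). As `τ`
has order 3, `σ ^ 3` is the scalar `n`, the norm of `c`.

Restrict `σ` to a fixed plane `π`: either `π` has a cyclic vector `x` (a triangle orbit), or `σ`
satisfies a quadratic equation on `π` (`exists_linearIndependent_or_quadratic_of_invariant`).

In the cyclic case `π` is spanned by the orbit of `x`, and the type of the point `⟨x⟩` of `PG(2, K)`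
is the type of `π`: Type I makes `π` a spread plane, and Type II puts `π` in a fixed line, which has
no Type III points. Pointwise fixed planes and h-planes contain no triangle orbit.

In the quadratic case no triangle orbit exists, and `π` is not an `𝕊_I`-plane because `1`, `τ`, `τ ^
2` are linearly independent. If `π` is not fixed pointwise, `σ ^ 3 = n` forces the quadratic to be
`X ^ 2 + a X + a ^ 2` with `a ^ 3 = n`. The kernel of this polynomial in `σ` has dimension 6 and
contains the range of `σ - a`, so it is hyperplanewise fixed and contains `π`. -/

theorem exists_submodule_ge_finrank_eq [FiniteDimensional k V] (W : Submodule k V) (d : ℕ)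
    (hW : finrank k W ≤ d) (hd : d ≤ finrank k V) :
    ∃ l : Submodule k V, finrank k l = d ∧ W ≤ l := by
  induction d, hW using Nat.le_induction with
  | base => exact ⟨W, rfl, le_rfl⟩
  | succ n _ ih =>
    obtain ⟨l, hl, hWl⟩ := ih (by omega)
    have hne : l ≠ ⊤ := by
      rintro rfl
      rw [finrank_top] at hl
      omega
    obtain ⟨v, -, hv⟩ := SetLike.exists_of_lt hne.lt_top
    exact ⟨l ⊔ Submodule.span k {v}, by rw [Submodule.finrank_sup_span_singleton hv, hl],
      hWl.trans le_sup_left⟩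

theorem collinear3_mk_iff [FiniteDimensional k V] (hV : 2 ≤ finrank k V) {x y z : V}
    (hx : x ≠ 0) (hy : y ≠ 0) (hz : z ≠ 0) :
    Collinear3 (.mk k x hx) (.mk k y hy) (.mk k z hz) ↔ ¬ LinearIndependent k ![x, y, z] := by
  simp only [Collinear3, Projectivization.submodule_mk, Submodule.span_singleton_le_iff_mem]
  constructor
  · rintro ⟨l, hl, h1, h2, h3⟩ hli
    have hle : Submodule.span k (Set.range ![x, y, z]) ≤ l := by
      rw [Submodule.span_le]
      rintro _ ⟨i, rfl⟩
      fin_cases i <;> assumption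
    have := Submodule.finrank_mono hle
    rw [finrank_span_eq_card hli, hl] at this
    simp at this
  · intro hli
    have hr : finrank k (Submodule.span k (Set.range ![x, y, z])) ≤ 2 := by
      have h3 := finrank_range_le_card (R := k) ![x, y, z]
      rw [linearIndependent_iff_card_eq_finrank_span] at hli
      simp only [Fintype.card_fin, Set.finrank] at h3 hli
      omega
    obtain ⟨l, hl, hle⟩ := exists_submodule_ge_finrank_eq _ 2 hr hV
    exact ⟨l, hl, hle (Submodule.subset_span ⟨0, rfl⟩), hle (Submodule.subset_span ⟨1, rfl⟩),
      hle (Submodule.subset_span ⟨2, rfl⟩)⟩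

open Polynomial in
-- With `X` acting as `f`, `V` is a finitely generated torsion `k[X]`-module over a PID, so a single
-- vector carries the full annihilator, that is, the minimal polynomial of `f`.
theorem exists_vector_annihilator_eq [FiniteDimensional k V] (f : Module.End k V) :
    ∃ x : V, ∀ p : k[X], aeval f p x = 0 → aeval f p = 0 := by
  obtain ⟨x, hx⟩ := exists_ker_toSpanSingleton_eq_annihilator k[X] (AEval' f)
  obtain ⟨x, rfl⟩ := (AEval'.of _).surjective x
  refine ⟨x, fun p hp ↦ ?_⟩
  have h : p ∈ Module.annihilator k[X] (AEval' f) := by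
    rw [← hx, LinearMap.mem_ker, LinearMap.toSpanSingleton_apply]
    have := AEval.of_aeval_smul (R := k) (M := V) (a := f) p x
    rw [End.smul_def, hp, map_zero] at this
    exact this.symm
  rw [AEval.annihilator_eq_ker_aeval] at h
  exact h

/-- An endomorphism without cyclic vector for three steps satisfies a quadratic equation. -/
theorem exists_linearIndependent_or_quadratic [FiniteDimensional k V] (f : Module.End k V) :
    (∃ x, LinearIndependent k ![x, f x, f (f x)]) ∨
      ∃ a b : k, ∀ x, f (f x) = a • f x + b • x := by
  obtain ⟨x, hx⟩ := exists_vector_annihilator_eq f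
  rw [or_iff_not_imp_left]
  intro h
  have hli : ¬ LinearIndependent k ![x, f x, f (f x)] := fun h' ↦ h ⟨x, h'⟩
  rw [Fintype.not_linearIndependent_iff] at hli
  obtain ⟨g, hg, hne⟩ := hli
  -- The relation at `x` is a polynomial in `f` killing `x`, hence killing every vector.
  have key : ∀ y, g 0 • y + g 1 • f y + g 2 • f (f y) = 0 := by
    have h0 := hx (.C (g 0) + .C (g 1) * .X + .C (g 2) * .X ^ 2)
      (by simpa [Fin.sum_univ_three, pow_two, Module.algebraMap_end_apply] using hg)
    intro y
    simpa [pow_two, Module.algebraMap_end_apply] using LinearMap.congr_fun h0 y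
  by_cases h2 : g 2 = 0
  · by_cases h1 : g 1 = 0
    · have h0 : g 0 ≠ 0 := by
        obtain ⟨i, hi⟩ := hne
        fin_cases i <;> simp_all
      have hz : ∀ y : V, y = 0 := fun y ↦ by simpa [h1, h2, h0] using key y
      exact ⟨0, 0, fun y ↦ by rw [hz (f (f y))]; simp⟩
    -- A relation of degree 1 is raised to degree 2 by applying it to `f y`.
    · refine ⟨-(g 0 / g 1), 0, fun y ↦ ?_⟩
      have := congrArg (fun v ↦ (g 1)⁻¹ • v) (key (f y))
      simp only [h2, zero_smul, add_zero, smul_add, smul_smul, inv_mul_cancel₀ h1, one_smul,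
        smul_zero] at this
      rw [zero_smul, add_zero, neg_smul, div_eq_inv_mul]
      exact eq_neg_of_add_eq_zero_right this
  · refine ⟨-(g 1 / g 2), -(g 0 / g 2), fun y ↦ ?_⟩
    have := congrArg (fun v ↦ (g 2)⁻¹ • v) (key y)
    simp only [smul_add, smul_smul, inv_mul_cancel₀ h2, one_smul, smul_zero] at this
    rw [neg_smul, neg_smul, div_eq_inv_mul, div_eq_inv_mul, eq_neg_of_add_eq_zero_right this]
    abel

theorem exists_linearIndependent_or_quadratic_of_invariant [FiniteDimensional k V]
    (f : Module.End k V) (W : Submodule k V) (hW : ∀ x ∈ W, f x ∈ W) :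
    (∃ x ∈ W, LinearIndependent k ![x, f x, f (f x)]) ∨
      ∃ a b : k, ∀ x ∈ W, f (f x) = a • f x + b • x := by
  refine (exists_linearIndependent_or_quadratic (f.restrict hW)).imp ?_ ?_
  · rintro ⟨x, hx⟩
    refine ⟨x, x.2, ?_⟩
    have h := hx.map' W.subtype W.ker_subtype
    have he : ![(x : V), f x, f (f x)] =
        W.subtype ∘ ![x, f.restrict hW x, f.restrict hW (f.restrict hW x)] := by
      ext i
      fin_cases i <;> rfl
    rw [he]
    exact h
  · rintro ⟨a, b, h⟩
    exact ⟨a, b, fun x hx ↦ congrArg Subtype.val (h ⟨x, hx⟩)⟩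

theorem exists_dual_eigenvalue [FiniteDimensional k V] (f : V ≃ₗ[k] V) (φ : Dual k V) (hφ : φ ≠ 0)
    (h : (LinearMap.ker φ).map f.toLinearMap = LinearMap.ker φ) :
    ∃ a : k, ∀ x, φ (f x) = a * φ x := by
  obtain ⟨y, hy⟩ : ∃ y, φ y ≠ 0 := by
    by_contra! hc
    exact hφ (LinearMap.ext hc)
  refine ⟨φ (f y) / φ y, fun x ↦ ?_⟩
  -- This combination lies in the invariant kernel; expanding `φ (f _) = 0` gives the eigenvalue `φ
  -- (f y) / φ y`.
  have hm : f (φ y • x - φ x • y) ∈ LinearMap.ker φ := by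
    rw [← h]
    exact Submodule.mem_map_of_mem (by simp [mul_comm])
  simp only [map_sub, map_smul, LinearMap.mem_ker, smul_eq_mul] at hm
  field_simp
  linear_combination hm

theorem exists_eq_smul_of_forall_exists (f : V →ₗ[k] V) (h : ∀ v, ∃ a : k, f v = a • v) :
    ∃ a : k, ∀ v, f v = a • v := by
  obtain ⟨a, ha⟩ := LinearMap.exists_eq_smul_id_of_forall_notLinearIndependent (f := f) (by
    intro v
    obtain ⟨a, ha⟩ := h v
    rw [Fintype.not_linearIndependent_iff]
    exact ⟨![a, -1], by simp [ha], 1, by simp⟩)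
  exact ⟨a, fun v ↦ by simp [ha]⟩

/-- If every hyperplane containing `U` is invariant, then `f` acts on `V ⧸ U` as a scalar. -/
theorem exists_sub_smul_mem_of_hyperplanes_fixed [FiniteDimensional k V] (f : V ≃ₗ[k] V)
    (U : Submodule k V)
    (hU : ∀ H : Submodule k V, finrank k H + 1 = finrank k V → U ≤ H → H.map f.toLinearMap = H) :
    ∃ a : k, ∀ x, f x - a • x ∈ U := by
  have hdual : ∀ φ ∈ U.dualAnnihilator, ∃ a : k, ∀ x, φ (f x) = a * φ x := by
    intro φ hφ
    by_cases h0 : φ = 0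
    · exact ⟨0, fun x ↦ by simp [h0]⟩
    · refine exists_dual_eigenvalue f φ h0 (hU _ (Dual.finrank_ker_add_one_of_ne_zero h0) ?_)
      rw [Submodule.mem_dualAnnihilator] at hφ
      exact fun x hx ↦ hφ x hx
  have hinv : ∀ φ ∈ U.dualAnnihilator, f.toLinearMap.dualMap φ ∈ U.dualAnnihilator := by
    intro φ hφ
    obtain ⟨a, ha⟩ := hdual φ hφ
    rw [Submodule.mem_dualAnnihilator] at hφ ⊢
    intro x hx
    simp [ha, hφ x hx]
  -- All functionals vanishing on `U` are eigenvectors of the transpose of `f`, so they share one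
  -- eigenvalue.
  obtain ⟨a, ha⟩ := exists_eq_smul_of_forall_exists
    (V := U.dualAnnihilator) (f.toLinearMap.dualMap.restrict hinv) (by
    intro φ
    obtain ⟨a, ha⟩ := hdual φ φ.2
    refine ⟨a, Subtype.ext (LinearMap.ext fun x ↦ ?_)⟩
    simp [ha])
  refine ⟨a, fun x ↦ ?_⟩
  rw [← Subspace.dualAnnihilator_dualCoannihilator_eq (W := U), Submodule.mem_dualCoannihilator]
  intro φ hφ
  have := congrArg (fun g : U.dualAnnihilator ↦ g.1 x) (ha ⟨φ, hφ⟩)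
  simpa [sub_eq_zero] using this

theorem map_eq_of_sub_smul_mem [FiniteDimensional k V] (f : V ≃ₗ[k] V) (U H : Submodule k V)
    (a : k) (h : ∀ x, f x - a • x ∈ U) (hUH : U ≤ H) : H.map f.toLinearMap = H := by
  refine Submodule.eq_of_le_of_finrank_eq ?_ (f.finrank_map_eq H)
  rintro _ ⟨x, hx, rfl⟩
  have := H.add_mem (hUH (h x)) (H.smul_mem a hx)
  simpa using this

theorem span_orbit_eq [FiniteDimensional k V] {x y z : V} (h : LinearIndependent k ![x, y, z])
    {W : Submodule k V} (hW : finrank k W = 3) (hx : x ∈ W) (hy : y ∈ W) (hz : z ∈ W) :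
    Submodule.span k (Set.range ![x, y, z]) = W := by
  refine Submodule.eq_of_le_of_finrank_eq ?_ (by rw [finrank_span_eq_card h, hW]; rfl)
  rw [Submodule.span_le]
  rintro _ ⟨i, rfl⟩
  fin_cases i <;> assumption

end LinearAlgebra

/-! ### Maps `y ↦ c * τ y` on a cubic extension. -/

section CubicExtension

variable {F K : Type*} [Field F] [Field K] [Algebra F K]

/-- The fixed field of `τ` has degree dividing the prime 3, and it is not all of `K`. -/
theorem exists_algebraMap_eq_of_fixed (hK : finrank F K = 3) {τ : K →ₐ[F] K}
    (hτ : τ ≠ AlgHom.id F K) {x : K} (hx : τ x = x) : ∃ a : F, algebraMap F K a = x := by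
  have : FiniteDimensional F K := FiniteDimensional.of_finrank_pos (by omega)
  let L : Subalgebra F K := AlgHom.equalizer τ (AlgHom.id F K)
  have hL : ∀ y, y ∈ L ↔ τ y = y := fun y ↦ AlgHom.mem_equalizer _ _ _
  let L' : IntermediateField F K := L.toIntermediateField' (Subalgebra.isField_of_algebraic L)
  have hmem : ∀ y, y ∈ L' ↔ τ y = y := hL
  have hmul := finrank_mul_finrank F L' K
  rw [hK] at hmul
  rcases (Nat.dvd_prime Nat.prime_three).1 ⟨_, hmul.symm⟩ with h | h
  · rw [IntermediateField.finrank_eq_one_iff] at h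
    have := (hmem x).2 hx
    rwa [h, IntermediateField.mem_bot] at this
  · have h1 : finrank L' K = 1 := by rw [h] at hmul; omega
    have htop : L' = ⊤ := IntermediateField.finrank_eq_one_iff_eq_top.1 h1
    refine absurd (AlgHom.ext fun y ↦ ?_) hτ
    exact (hmem y).1 (htop ▸ IntermediateField.mem_top)

theorem algHom_cube_apply [Finite F] (hK : finrank F K = 3) (τ : K →ₐ[F] K) (x : K) :
    τ (τ (τ x)) = x := by
  have : FiniteDimensional F K := FiniteDimensional.of_finrank_pos (by omega)
  have : Finite K := Module.finite_of_finite F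
  let e : K ≃ₐ[F] K := AlgEquiv.ofBijective τ (Algebra.IsAlgebraic.algHom_bijective τ)
  have h : e ^ Nat.card (K ≃ₐ[F] K) = 1 := pow_card_eq_one'
  rw [IsGalois.card_aut_eq_finrank, hK] at h
  exact DFunLike.congr_fun h x

variable {τ : K →ₐ[F] K}

/-- Dedekind's independence of the three distinct characters `τ ^ 2`, `τ` and the identity. -/
theorem eq_zero_of_forall_quadratic (hτ : τ ≠ AlgHom.id F K) (hτ3 : ∀ x, τ (τ (τ x)) = x)
    {A B C : K} (h : ∀ y, A * τ (τ y) + B * τ y + C * y = 0) : A = 0 := by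
  let m : Fin 3 → (K →* K) := ![((τ.comp τ : K →ₐ[F] K) : K →* K), (τ : K →* K), MonoidHom.id K]
  have h1 : ∃ x, τ x ≠ x := by
    by_contra! hc
    exact hτ (AlgHom.ext hc)
  obtain ⟨x, hx⟩ := h1
  have hinj : Function.Injective τ := τ.toRingHom.injective
  have h01 : m 0 ≠ m 1 := fun he ↦ hx (hinj (DFunLike.congr_fun he x))
  have h12 : m 1 ≠ m 2 := fun he ↦ hx (DFunLike.congr_fun he x)
  have h02 : m 0 ≠ m 2 := fun he ↦ hx (by
    have h2 : τ (τ (τ x)) = τ x := DFunLike.congr_fun he (τ x)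
    rw [← h2, hτ3])
  have hm : Function.Injective m := by
    intro i j hij
    fin_cases i <;> fin_cases j <;>
      first
      | rfl
      | exact absurd hij h01
      | exact absurd hij h12
      | exact absurd hij h02
      | exact absurd hij.symm h01
      | exact absurd hij.symm h12
      | exact absurd hij.symm h02
  have hli := (linearIndependent_monoidHom K K).comp m hm
  rw [Fintype.linearIndependent_iff] at hli
  refine hli ![A, B, C] ?_ 0
  ext y
  simpa [Fin.sum_univ_three, m] using h y

theorem no_quadratic_semilinear (hτ : τ ≠ AlgHom.id F K) (hτ3 : ∀ x, τ (τ (τ x)) = x)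
    {c : K} (hc : c ≠ 0) (a b : F) :
    ¬ ∀ y, c * τ (c * τ y) = a • (c * τ y) + b • y := by
  intro h
  have h0 : c * τ c = 0 := by
    refine eq_zero_of_forall_quadratic hτ hτ3 (B := -(algebraMap F K a * c))
      (C := -algebraMap F K b) fun y ↦ ?_
    have := h y
    rw [map_mul, Algebra.smul_def, Algebra.smul_def] at this
    linear_combination this
  have hinj : Function.Injective τ := τ.toRingHom.injective
  simp [hc, map_eq_zero_iff τ hinj] at h0

/-- The quotient of two eigenvectors with the same eigenvalue is fixed by `τ`, hence lies in `F`. -/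
theorem finrank_ker_sub_smul_le_one (hK : finrank F K = 3) (hτ : τ ≠ AlgHom.id F K)
    {c : K} (hc : c ≠ 0) (t : End F K) (ht : ∀ y, t y = c * τ y) (a : F) :
    finrank F (LinearMap.ker (t - a • 1)) ≤ 1 := by
  have hker : ∀ y, y ∈ LinearMap.ker (t - a • 1) ↔ c * τ y = a • y := fun y ↦ by
    simp [ht, sub_eq_zero]
  by_cases hbot : ∃ x ∈ LinearMap.ker (t - a • 1), x ≠ 0
  · obtain ⟨x, hx, hx0⟩ := hbot
    refine finrank_le_one ⟨x, hx⟩ fun ⟨y, hy⟩ ↦ ?_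
    have hx' := (hker x).1 hx
    have hy' := (hker y).1 hy
    rw [Algebra.smul_def] at hx' hy'
    have hinj : Function.Injective τ := τ.toRingHom.injective
    have htx : τ x ≠ 0 := by simpa [map_eq_zero_iff τ hinj] using hx0
    obtain ⟨r, hr⟩ := exists_algebraMap_eq_of_fixed hK hτ (x := y / x) (by
      rw [map_div₀, div_eq_div_iff htx hx0]
      apply mul_left_cancel₀ hc
      linear_combination x * hy' - y * hx')
    refine ⟨r, Subtype.ext ?_⟩
    simp only [SetLike.mk_smul_mk, Algebra.smul_def, hr]
    field_simp
  · push Not at hbot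
    have : LinearMap.ker (t - a • 1) = ⊥ := (Submodule.eq_bot_iff _).2 hbot
    rw [this, finrank_bot]
    omega

/-- Since `(t - a)(t ^ 2 + a t + a ^ 2) = 0`, the range of the quadratic lies in the eigenspace of
`a`, of dimension at most 1. It is nonzero, as `t` satisfies no quadratic equation, so the kernel
has dimension 3 - 1. -/
theorem finrank_ker_quadratic (hK : finrank F K = 3) (hτ : τ ≠ AlgHom.id F K)
    (hτ3 : ∀ x, τ (τ (τ x)) = x) {c : K} (hc : c ≠ 0) (t : End F K) (ht : ∀ y, t y = c * τ y)
    (a : F) (ha : ∀ y, t (t (t y)) = a ^ 3 • y) :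
    finrank F (LinearMap.ker (t ^ 2 + a • t + a ^ 2 • 1)) = 2 := by
  have : FiniteDimensional F K := FiniteDimensional.of_finrank_pos (by omega)
  have hrn := (t ^ 2 + a • t + a ^ 2 • 1).finrank_range_add_finrank_ker
  have hle : LinearMap.range (t ^ 2 + a • t + a ^ 2 • 1) ≤ LinearMap.ker (t - a • 1) := by
    rintro _ ⟨y, rfl⟩
    simp only [pow_two, LinearMap.add_apply, Module.End.mul_apply, LinearMap.smul_apply,
      Module.End.one_apply, LinearMap.mem_ker, LinearMap.sub_apply, map_add, map_smul, ha]
    module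
  have h1 := (Submodule.finrank_mono hle).trans (finrank_ker_sub_smul_le_one hK hτ hc t ht a)
  have h0 : finrank F (LinearMap.range (t ^ 2 + a • t + a ^ 2 • 1)) ≠ 0 := by
    rw [Submodule.finrank_eq_zero.ne, Ne, LinearMap.range_eq_bot]
    intro h
    refine no_quadratic_semilinear hτ hτ3 hc (-a) (-a ^ 2) fun y ↦ ?_
    have := LinearMap.congr_fun h y
    simp only [pow_two, LinearMap.add_apply, Module.End.mul_apply, LinearMap.smul_apply,
      Module.End.one_apply, LinearMap.zero_apply] at this
    rw [← ht, ← ht, ← sub_eq_zero, ← this]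
    module
  omega

theorem finrank_ker_coordinatewise [FiniteDimensional F K]
    (b : Basis (Fin 3) K (Fin 3 → K)) (p : End F K)
    (P : End F (Fin 3 → K)) (h : ∀ x i, b.repr (P x) i = p (b.repr x i)) :
    finrank F (LinearMap.ker P) = 3 * finrank F (LinearMap.ker p) := by
  let g : (Fin 3 → LinearMap.ker p) →ₗ[F] (Fin 3 → K) :=
    (b.equivFun.symm.restrictScalars F).toLinearMap ∘ₗ
      LinearMap.pi fun i ↦ (LinearMap.ker p).subtype ∘ₗ LinearMap.proj i
  have hg : ∀ v i, b.repr (g v) i = v i := fun v i ↦ by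
    change b.equivFun (b.equivFun.symm fun i ↦ (v i : K)) i = v i
    rw [LinearEquiv.apply_symm_apply]
  have hginj : Function.Injective g := fun v w hvw ↦ by
    ext i
    rw [← hg, ← hg, hvw]
  have hrange : LinearMap.range g = LinearMap.ker P := by
    ext x
    constructor
    · rintro ⟨v, rfl⟩
      rw [LinearMap.mem_ker]
      apply b.repr.injective
      ext i
      rw [h, hg, LinearMap.mem_ker.1 (v i).2, map_zero, Finsupp.zero_apply]
    · intro hx
      refine ⟨fun i ↦ ⟨b.repr x i, ?_⟩, b.repr.injective ?_⟩
      · rw [LinearMap.mem_ker, ← h, LinearMap.mem_ker.1 hx, map_zero, Finsupp.zero_apply]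
      · ext i
        rw [hg]
  rw [← hrange, LinearMap.finrank_range_of_inj hginj, finrank_pi_fintype]
  simp

end CubicExtension

/-! ### Coordinates: the semilinear form of `σ`. -/

section Inducing

variable {F K : Type*} [Field F] [Field K] [Algebra F K]
  {φ : Equiv.Perm (Projectivization K (Fin 3 → K))}
  {σ : (Fin 3 → K) ≃ₗ[F] (Fin 3 → K)}

theorem mem_spreadPlane_mk {x y : Fin 3 → K} (hx : x ≠ 0) :
    y ∈ spreadPlane F (.mk K x hx) ↔ ∃ k : K, k • x = y := by
  rw [spreadPlane, Submodule.restrictScalars_mem, Projectivization.submodule_mk,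
    Submodule.mem_span_singleton]

theorem Induces.apply_mk (hσ : Induces σ φ) {x : Fin 3 → K} (hx : x ≠ 0) :
    φ (.mk K x hx) = .mk K (σ x) (σ.map_ne_zero_iff.2 hx) := by
  apply Projectivization.submodule_injective
  symm
  refine Submodule.eq_of_le_of_finrank_eq ?_ (by simp only [Projectivization.finrank_submodule])
  rw [Projectivization.submodule_mk, Submodule.span_singleton_le_iff_mem]
  change σ x ∈ spreadPlane F (φ (.mk K x hx))
  rw [← hσ]
  exact Submodule.mem_map_of_mem ((mem_spreadPlane_mk hx).2 ⟨1, one_smul _ _⟩)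

theorem Induces.exists_smul_eq (hσ : Induces σ φ) (k : K) (x : Fin 3 → K) :
    ∃ l : K, l • σ x = σ (k • x) := by
  by_cases hx : x = 0
  · exact ⟨0, by simp [hx]⟩
  · have h : σ (k • x) ∈ spreadPlane F (φ (.mk K x hx)) := by
      rw [← hσ]
      exact Submodule.mem_map_of_mem ((mem_spreadPlane_mk hx).2 ⟨k, rfl⟩)
    rwa [hσ.apply_mk, mem_spreadPlane_mk] at h

theorem Induces.exists_smul_eq_of_fixed (hσ : Induces σ φ) {x : Fin 3 → K} (hx : x ≠ 0)
    (hfix : φ (.mk K x hx) = .mk K x hx) (k : K) : ∃ l : K, l • x = σ (k • x) := by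
  rw [← mem_spreadPlane_mk (F := F) hx, ← hfix, ← hσ]
  exact Submodule.mem_map_of_mem ((mem_spreadPlane_mk hx).2 ⟨k, rfl⟩)

/-- A projectivity inducing a collineation that fixes the points of an `F`-plane with basis `b`
acts on all coordinates with respect to `b` in the same way. -/
theorem Induces.exists_coordinate_map (hσ : Induces σ φ) (b : Basis (Fin 3) K (Fin 3 → K))
    (hfix : ∀ P : Projectivization K (Fin 3 → K),
      (∃ a : Fin 3 → F, a ≠ 0 ∧ P.submodule = Submodule.span K {∑ i, a i • b i}) → φ P = P) :
    ∃ t : K → K, ∀ x i, b.repr (σ x) i = t (b.repr x i) := by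
  have hrepr : ∀ (a : Fin 3 → F) i, b.repr (∑ j, a j • b j) i = algebraMap F K (a i) := by
    intro a i
    have : ∑ j, a j • b j = b.equivFun.symm fun j ↦ algebraMap F K (a j) := by
      simp [Basis.equivFun_symm_apply]
    rw [this]
    change b.equivFun (b.equivFun.symm _) i = _
    rw [LinearEquiv.apply_symm_apply]
  have hline : ∀ (a : Fin 3 → F), a ≠ 0 → ∀ k : K, ∃ l : K,
      l • (∑ j, a j • b j) = σ (k • ∑ j, a j • b j) := by
    intro a ha k
    have h0 : ∑ j, a j • b j ≠ 0 := by
      intro h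
      apply ha
      ext i
      have := hrepr a i
      rw [h, map_zero, Finsupp.zero_apply, eq_comm] at this
      simpa using this
    exact hσ.exists_smul_eq_of_fixed h0
      (hfix _ ⟨a, ha, by rw [Projectivization.submodule_mk]⟩) k
  have hb : ∀ i (k : K), ∃ l : K, l • b i = σ (k • b i) := by
    intro i k
    have := hline (Pi.single i 1) (by simp) k
    simpa [Pi.single_apply] using this
  choose s hs using hb
  choose t ht using hline 1 one_ne_zero
  -- The unit point `b 0 + b 1 + b 2` is fixed too, which forces the three coordinate functions to
  -- agree.
  have hst : ∀ i k, s i k = t k := by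
    intro i k
    have h := ht k
    simp only [Pi.one_apply, one_smul, Finset.smul_sum, map_sum, ← hs] at h
    have := congrArg (fun v ↦ b.repr v i) h
    simpa [Finsupp.single_apply] using this.symm
  refine ⟨t, fun x i ↦ ?_⟩
  have hx : σ x = ∑ j, t (b.repr x j) • b j := by
    conv_lhs => rw [← b.sum_repr x]
    rw [map_sum]
    exact Finset.sum_congr rfl fun j _ ↦ by rw [← hs, hst]
  rw [hx, b.repr_sum_self]

theorem Induces.exists_semilinear (hσ : Induces σ φ) (hφ3 : orderOf φ = 3)
    (b : Basis (Fin 3) K (Fin 3 → K))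
    (hfix : ∀ P : Projectivization K (Fin 3 → K),
      (∃ a : Fin 3 → F, a ≠ 0 ∧ P.submodule = Submodule.span K {∑ i, a i • b i}) → φ P = P) :
    ∃ (τ : K →ₐ[F] K) (c : K), τ ≠ AlgHom.id F K ∧ c ≠ 0 ∧
      ∀ x i, b.repr (σ x) i = c * τ (b.repr x i) := by
  obtain ⟨t, ht⟩ := hσ.exists_coordinate_map b hfix
  have htk : ∀ k i, t k = b.repr (σ (k • b i)) i := fun k i ↦ by simp [ht]
  have hadd : ∀ k l, t (k + l) = t k + t l := fun k l ↦ by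
    rw [htk _ 0, htk k 0, htk l 0, add_smul, map_add, map_add, Finsupp.add_apply]
  have hsmul : ∀ (a : F) k, t (a • k) = algebraMap F K a * t k := fun a k ↦ by
    rw [htk _ 0, htk k 0, smul_assoc, map_smul, ← algebraMap_smul K a, map_smul,
      Finsupp.smul_apply, smul_eq_mul]
  have h0 : t 0 = 0 := by simpa using hsmul 0 0
  have hc : t 1 ≠ 0 := by
    intro h
    have : σ (b 0) = 0 := by
      apply b.repr.injective
      ext i
      rw [ht]
      by_cases hi : (0 : Fin 3) = i
      · subst hi
        simp [h]
      · simp [hi, h0]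
    exact b.ne_zero 0 (σ.map_eq_zero_iff.1 this)
  -- The `K`-line of `b 0 + l • b 1` goes to a `K`-line, so the same `m` satisfies `t k = m * t 1`
  -- and `t (k * l) = m * t l`. Normalising `t` by `t 1` then gives a ring homomorphism.
  have hmul : ∀ k l, t (k * l) * t 1 = t k * t l := by
    intro k l
    obtain ⟨m, hm⟩ := hσ.exists_smul_eq k (b 0 + l • b 1)
    have e0 := congrArg (fun v ↦ b.repr v 0) hm
    have e1 := congrArg (fun v ↦ b.repr v 1) hm
    simp [ht, h0] at e0 e1
    rw [← e0, ← e1]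
    ring
  let τ : K →ₐ[F] K :=
    { toFun := fun k ↦ t k / t 1
      map_one' := div_self hc
      map_mul' := fun k l ↦ by
        rw [div_mul_div_comm, div_eq_div_iff hc (mul_ne_zero hc hc)]
        linear_combination t 1 * hmul k l
      map_zero' := by rw [h0, zero_div]
      map_add' := fun k l ↦ by rw [hadd, add_div]
      commutes' := fun a ↦ by
        rw [Algebra.algebraMap_eq_smul_one, hsmul, mul_div_assoc, div_self hc, mul_one,
          Algebra.algebraMap_eq_smul_one] }
  have hτt : ∀ k, t 1 * τ k = t k := fun k ↦ mul_div_cancel₀ _ hc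
  refine ⟨τ, t 1, ?_, hc, fun x i ↦ by rw [ht, hτt]⟩
  -- If `τ` were the identity, `σ` would be multiplication by `t 1` and `φ` trivial.
  intro hid
  have : φ = 1 := by
    ext1 P
    induction P using Projectivization.ind with | _ x hx =>
    rw [hσ.apply_mk, Equiv.Perm.one_apply, Projectivization.mk_eq_mk_iff']
    refine ⟨t 1, b.repr.injective ?_⟩
    ext i
    rw [ht, ← hτt (b.repr x i), hid, map_smul]
    rfl
  rw [this, orderOf_one] at hφ3
  omega

end Inducing

/-! ### Hyperplanewise fixed 5-spaces. -/

section Semilinear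

variable {F K : Type*} [Field F] [Field K] [Algebra F K]
  {φ : Equiv.Perm (Projectivization K (Fin 3 → K))}
  {σ : (Fin 3 → K) ≃ₗ[F] (Fin 3 → K)} {b : Basis (Fin 3) K (Fin 3 → K)}
  {τ : K →ₐ[F] K} {c : K}

theorem map_smul_of_coordinates (hb : ∀ x i, b.repr (σ x) i = c * τ (b.repr x i)) (k : K)
    (x : Fin 3 → K) : σ (k • x) = τ k • σ x := by
  apply b.repr.injective
  ext i
  simp [hb]
  ring

/-- The scalar is the norm `c * τ c * τ (τ c)`, which `τ` fixes. -/
theorem exists_cube_eq_smul (hK : finrank F K = 3) (hτ : τ ≠ AlgHom.id F K)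
    (hτ3 : ∀ x, τ (τ (τ x)) = x) (c : K) :
    ∃ n : F, ∀ y, c * τ (c * τ (c * τ y)) = n • y := by
  obtain ⟨n, hn⟩ := exists_algebraMap_eq_of_fixed hK hτ (x := c * τ c * τ (τ c)) (by
    simp only [map_mul, hτ3]
    ring)
  refine ⟨n, fun y ↦ ?_⟩
  simp only [Algebra.smul_def, hn, map_mul, hτ3]
  ring

theorem cube_apply_of_coordinates (hb : ∀ x i, b.repr (σ x) i = c * τ (b.repr x i)) {n : F}
    (hn : ∀ y, c * τ (c * τ (c * τ y)) = n • y) (x : Fin 3 → K) : σ (σ (σ x)) = n • x := by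
  apply b.repr.injective
  ext i
  rw [hb, hb, hb, hn, ← algebraMap_smul K n x, map_smul, Finsupp.smul_apply, algebraMap_smul]

/-- The `F`-linear map giving the action on each coordinate. -/
noncomputable def coordinateMap (τ : K →ₐ[F] K) (c : K) : End F K :=
  LinearMap.mulLeft F c ∘ₗ τ.toLinearMap

theorem coordinateMap_apply (y : K) : coordinateMap τ c y = c * τ y := rfl

/-- The kernel of `σ² + aσ + a²` is hyperplanewise fixed if `a³ = n`. -/
theorem isHwiseFixedSpace_ker_quadratic (hK : finrank F K = 3) (hτ : τ ≠ AlgHom.id F K)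
    (hτ3 : ∀ x, τ (τ (τ x)) = x) (hc : c ≠ 0)
    (hb : ∀ x i, b.repr (σ x) i = c * τ (b.repr x i)) {a : F}
    (hn : ∀ y, c * τ (c * τ (c * τ y)) = a ^ 3 • y) :
    IsHwiseFixedSpace σ
      (LinearMap.ker (σ.toLinearMap ^ 2 + a • σ.toLinearMap + a ^ 2 • 1 : End F (Fin 3 → K))) := by
  have : FiniteDimensional F K := FiniteDimensional.of_finrank_pos (by omega)
  constructor
  · rw [finrank_ker_coordinatewise b
      (coordinateMap τ c ^ 2 + a • coordinateMap τ c + a ^ 2 • 1),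
      finrank_ker_quadratic hK hτ hτ3 hc _ coordinateMap_apply a hn]
    intro x i
    simp only [pow_two, LinearMap.add_apply, Module.End.mul_apply, LinearMap.smul_apply,
      Module.End.one_apply, LinearEquiv.coe_coe, ← algebraMap_smul K a, map_add,
      ← algebraMap_smul K (a * a), map_smul, coordinateMap_apply, Finsupp.add_apply,
      Finsupp.smul_apply, hb]
  · intro H _ hUH
    -- `σ` is the scalar `a` modulo this kernel, because `(σ ^ 2 + a σ + a ^ 2)(σ - a) = σ ^ 3 - a ^
    -- 3 = 0`.
    refine map_eq_of_sub_smul_mem σ _ H a (fun x ↦ ?_) hUH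
    have := cube_apply_of_coordinates hb hn x
    simp only [pow_two, LinearMap.add_apply, Module.End.mul_apply, LinearMap.smul_apply,
      Module.End.one_apply, LinearMap.mem_ker, LinearEquiv.coe_coe, map_sub, map_smul, this]
    module

/-- A hyperplanewise fixed 5-space contains no point with a triangle as orbit. -/
theorem IsHwiseFixedSpace.not_linearIndependent (hK : finrank F K = 3) (hτ : τ ≠ AlgHom.id F K)
    (hτ3 : ∀ x, τ (τ (τ x)) = x) (hc : c ≠ 0)
    (hb : ∀ x i, b.repr (σ x) i = c * τ (b.repr x i)) {U : Submodule F (Fin 3 → K)}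
    (hU : IsHwiseFixedSpace σ U) {x : Fin 3 → K} (hx : x ∈ U) :
    ¬ LinearIndependent F ![x, σ x, σ (σ x)] := by
  have : FiniteDimensional F K := FiniteDimensional.of_finrank_pos (by omega)
  have hV : finrank F (Fin 3 → K) = 9 := by rw [finrank_pi_fintype]; simp [hK]
  obtain ⟨a, ha⟩ := exists_sub_smul_mem_of_hyperplanes_fixed σ U fun H hH hle ↦
    hU.2 H (by omega) hle
  let f : End F (Fin 3 → K) := σ.toLinearMap - a • 1
  have hf : ∀ y, f y = σ y - a • y := fun y ↦ rfl
  have hrn := f.finrank_range_add_finrank_ker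
  have hker : finrank F (LinearMap.ker f) ≤ 3 := by
    rw [finrank_ker_coordinatewise b (coordinateMap τ c - a • 1)]
    · have := finrank_ker_sub_smul_le_one hK hτ hc (coordinateMap τ c) coordinateMap_apply a
      omega
    · intro y i
      simp only [LinearMap.sub_apply, LinearMap.smul_apply, Module.End.one_apply, hf,
        ← algebraMap_smul K a, map_sub, map_smul, coordinateMap_apply, Finsupp.sub_apply,
        Finsupp.smul_apply, hb]
  have hle : LinearMap.range f ≤ U := by
    rintro _ ⟨y, rfl⟩
    exact ha y
  have hU6 := hU.1
  have hle6 := Submodule.finrank_mono hle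
  -- The kernel of `f` has dimension at most 3 out of 9, so its range has dimension at least 6 and
  -- fills `U`.
  have hrange : LinearMap.range f = U := Submodule.eq_of_le_of_finrank_eq hle (by omega)
  obtain ⟨n, hn⟩ := exists_cube_eq_smul hK hτ hτ3 c
  have h3 := cube_apply_of_coordinates hb hn
  have hpos : 0 < finrank F (LinearMap.ker f) := by omega
  have hnt := finrank_pos_iff.1 hpos
  obtain ⟨⟨z, hz⟩, hz0⟩ := exists_ne (0 : LinearMap.ker f)
  have hz0 : z ≠ 0 := fun h ↦ hz0 (Subtype.ext h)
  have hσz : σ z = a • z := sub_eq_zero.1 (LinearMap.mem_ker.1 hz)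
  -- An eigenvector for `a` identifies the scalar `σ ^ 3`; then `σ ^ 2 + a σ + a ^ 2` kills the
  -- range of `σ - a`, which is `U`.
  have hna : n = a ^ 3 := by
    have := h3 z
    simp only [hσz, map_smul, smul_smul] at this
    rw [← smul_left_injective F hz0 this]
    ring
  rw [← hrange] at hx
  obtain ⟨y, rfl⟩ := hx
  rw [Fintype.not_linearIndependent_iff]
  refine ⟨![a ^ 2, a, 1], ?_, 2, by simp⟩
  simp only [Fin.sum_univ_three, Matrix.cons_val_zero, Matrix.cons_val_one, Matrix.cons_val, hf,
    map_sub, map_smul, h3, hna]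
  module

end Semilinear

/-! ### Fixed planes and the types of their points. -/

section FixedPlanes

variable {F K : Type*} [Field F] [Field K] [Algebra F K]
  {φ : Equiv.Perm (Projectivization K (Fin 3 → K))}
  {σ : (Fin 3 → K) ≃ₗ[F] (Fin 3 → K)}

theorem act_mk {x : Fin 3 → K} (hx : x ≠ 0) :
    act σ (.mk F x hx) = .mk F (σ x) (σ.map_ne_zero_iff.2 hx) := rfl

theorem isTriangleOrbit_mk_iff (hK : finrank F K = 3) {x : Fin 3 → K} (hx : x ≠ 0) :
    IsTriangleOrbit σ (.mk F x hx) ↔ LinearIndependent F ![x, σ x, σ (σ x)] := by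
  have : FiniteDimensional F K := FiniteDimensional.of_finrank_pos (by omega)
  have hV : 2 ≤ finrank F (Fin 3 → K) := by rw [finrank_pi_fintype]; simp [hK]
  rw [IsTriangleOrbit, act_mk, act_mk, collinear3_mk_iff hV, not_not]

/-- Spread planes partition the points, so `P` is the `K`-span of any vector of `X`. The predicate
`T` is left free to serve Types II and III alike. -/
theorem exists_triangleOrbit_iff (hK : finrank F K = 3)
    (T : Projectivization K (Fin 3 → K) → Prop) (π : Submodule F (Fin 3 → K)) :
    (∃ X : Projectivization F (Fin 3 → K),
      ((∃ P, T P ∧ X.submodule ≤ spreadPlane F P) ∧ IsTriangleOrbit σ X) ∧ X.submodule ≤ π) ↔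
    ∃ (x : Fin 3 → K) (hx : x ≠ 0), T (.mk K x hx) ∧
      LinearIndependent F ![x, σ x, σ (σ x)] ∧ x ∈ π := by
  constructor
  · rintro ⟨X, ⟨⟨P, hP, hXP⟩, hX⟩, hXπ⟩
    induction X using Projectivization.ind with | _ x hx =>
    rw [Projectivization.submodule_mk, Submodule.span_singleton_le_iff_mem] at hXP hXπ
    refine ⟨x, hx, ?_, (isTriangleOrbit_mk_iff hK hx).1 hX, hXπ⟩
    induction P using Projectivization.ind with | _ y hy =>
    rw [mem_spreadPlane_mk] at hXP
    rwa [(Projectivization.mk_eq_mk_iff' K x y hx hy).2 hXP]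
  · rintro ⟨x, hx, hT, hli, hπ⟩
    refine ⟨.mk F x hx, ⟨⟨_, hT, ?_⟩, (isTriangleOrbit_mk_iff hK hx).2 hli⟩, ?_⟩ <;>
      rw [Projectivization.submodule_mk, Submodule.span_singleton_le_iff_mem]
    · exact (mem_spreadPlane_mk hx).2 ⟨1, one_smul _ _⟩
    · exact hπ

theorem finrank_spreadPlane (hK : finrank F K = 3) (P : Projectivization K (Fin 3 → K)) :
    finrank F (spreadPlane F P) = 3 := by
  have h := finrank_mul_finrank F K P.submodule
  rw [P.finrank_submodule, hK] at h
  exact h.symm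

theorem IsFixedPlane.apply_mem {π : Submodule F (Fin 3 → K)} (hπ : IsFixedPlane σ π)
    {x : Fin 3 → K} (hx : x ∈ π) : σ x ∈ π := by
  have := Submodule.mem_map_of_mem (f := σ.toLinearMap) hx
  rwa [hπ.2] at this

theorem Induces.apply_mem_spreadPlane (hσ : Induces σ φ) {P : Projectivization K (Fin 3 → K)}
    {x : Fin 3 → K} (hx : x ∈ spreadPlane F P) : σ x ∈ spreadPlane F (φ P) := by
  rw [← hσ]
  exact Submodule.mem_map_of_mem hx

theorem self_mem_spreadPlane {x : Fin 3 → K} (hx : x ≠ 0) : x ∈ spreadPlane F (.mk K x hx) :=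
  (mem_spreadPlane_mk hx).2 ⟨1, one_smul _ _⟩

/-- Both planes are invariant and contain `x`, so both are spanned by its orbit. -/
theorem IsFixedPlane.eq_spreadPlane (hK : finrank F K = 3) (hσ : Induces σ φ)
    {π : Submodule F (Fin 3 → K)} (hπ : IsFixedPlane σ π) {x : Fin 3 → K} (hx : x ≠ 0)
    (hxπ : x ∈ π) (hli : LinearIndependent F ![x, σ x, σ (σ x)])
    (hI : IsTypeIPoint φ (.mk K x hx)) : π = spreadPlane F (.mk K x hx) := by
  have : FiniteDimensional F K := FiniteDimensional.of_finrank_pos (by omega)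
  have hmem : ∀ y ∈ spreadPlane F (.mk K x hx), σ y ∈ spreadPlane F (.mk K x hx) := by
    intro y hy
    have := hσ.apply_mem_spreadPlane hy
    rwa [hI] at this
  have h0 := self_mem_spreadPlane (F := F) hx
  rw [← span_orbit_eq hli hπ.1 hxπ (hπ.apply_mem hxπ) (hπ.apply_mem (hπ.apply_mem hxπ)),
    ← span_orbit_eq hli (finrank_spreadPlane hK _) h0 (hmem _ h0) (hmem _ (hmem _ h0))]

theorem eq_span_pair {x y : Fin 3 → K} (hxy : LinearIndependent K ![x, y])
    {l : Submodule K (Fin 3 → K)} (hl : finrank K l = 2) (hx : x ∈ l) (hy : y ∈ l) :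
    l = Submodule.span K {x, y} := by
  symm
  refine Submodule.eq_of_le_of_finrank_eq ?_ ?_
  · rw [Submodule.span_le]
    rintro _ (rfl | rfl) <;> assumption
  · have := finrank_span_eq_card hxy
    rw [Matrix.range_cons_cons_empty] at this
    rw [this, hl]
    rfl

theorem Induces.linearIndependent_pair (hσ : Induces σ φ) {x : Fin 3 → K} (hx : x ≠ 0)
    (h : (.mk K x hx : Projectivization K (Fin 3 → K)) ≠ φ (.mk K x hx)) :
    LinearIndependent K ![x, σ x] := by
  rw [LinearIndependent.pair_iff' hx]
  intro a ha
  apply h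
  rw [hσ.apply_mk, eq_comm, Projectivization.mk_eq_mk_iff']
  exact ⟨a, ha⟩

/-- The line joining a Type II point to its image has Type I. -/
theorem Induces.exists_typeILine (hσ : Induces σ φ) (hφ3 : ∀ P, φ (φ (φ P)) = P)
    {x : Fin 3 → K} (hx : x ≠ 0) (hII : IsTypeIIPoint φ (.mk K x hx)) :
    ∃ l, IsTypeILine φ l ∧ x ∈ l ∧ σ x ∈ l ∧ σ (σ x) ∈ l := by
  obtain ⟨hne, -, -, l, hl, h0, h1, h2⟩ := hII
  rw [hσ.apply_mk] at h1 h2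
  rw [hσ.apply_mk] at h2
  rw [Projectivization.submodule_mk, Submodule.span_singleton_le_iff_mem] at h0 h1 h2
  have hspan := eq_span_pair (hσ.linearIndependent_pair hx hne) hl h0 h1
  have hmem : ∀ y ∈ l, σ y ∈ l := by
    intro y hy
    rw [hspan, Submodule.mem_span_pair] at hy
    obtain ⟨k, m, rfl⟩ := hy
    obtain ⟨k', hk⟩ := hσ.exists_smul_eq k x
    obtain ⟨m', hm⟩ := hσ.exists_smul_eq m (σ x)
    rw [map_add, ← hk, ← hm]
    exact l.add_mem (l.smul_mem _ h1) (l.smul_mem _ h2)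
  have hle : ∀ P : Projectivization K (Fin 3 → K), P.submodule ≤ l → (φ P).submodule ≤ l := by
    intro P hP
    induction P using Projectivization.ind with | _ y hy =>
    rw [hσ.apply_mk, Projectivization.submodule_mk, Submodule.span_singleton_le_iff_mem]
    rw [Projectivization.submodule_mk, Submodule.span_singleton_le_iff_mem] at hP
    exact hmem y hP
  refine ⟨l, ⟨hl, fun P ↦ ⟨fun h ↦ ?_, hle P⟩⟩, h0, h1, h2⟩
  -- The converse inclusion comes from applying `φ` twice more, as `φ ^ 3 = 1`.
  rw [← hφ3 P]
  exact hle _ (hle _ h)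

theorem IsTypeILine.not_typeIII {l : Submodule K (Fin 3 → K)} (hl : IsTypeILine φ l)
    {y : Fin 3 → K} (hy : y ≠ 0) (hyl : y ∈ l) : ¬ IsTypeIIIPoint φ (.mk K y hy) := by
  have h : (Projectivization.mk K y hy).submodule ≤ l := by
    rwa [Projectivization.submodule_mk, Submodule.span_singleton_le_iff_mem]
  exact not_not.2 ⟨l, hl.1, h, (hl.2 _).2 h, (hl.2 _).2 ((hl.2 _).2 h)⟩

theorem isTypeI_or_isTypeII_or_isTypeIII (hφ3 : ∀ P, φ (φ (φ P)) = P)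
    (P : Projectivization K (Fin 3 → K)) :
    IsTypeIPoint φ P ∨ IsTypeIIPoint φ P ∨ IsTypeIIIPoint φ P := by
  by_cases h1 : φ P = P
  · exact .inl h1
  · by_cases h3 : Collinear3 P (φ P) (φ (φ P))
    · refine .inr (.inl ⟨fun h ↦ h1 h.symm, fun h ↦ h1 (φ.injective h).symm, fun h ↦ h1 ?_, h3⟩)
      conv_lhs => rw [h]
      exact hφ3 P
    · exact .inr (.inr h3)

theorem IsTypeIPoint.not_typeIII {P : Projectivization K (Fin 3 → K)} (h : IsTypeIPoint φ P) :
    ¬ IsTypeIIIPoint φ P := by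
  have h1 : φ P = P := h
  rw [IsTypeIIIPoint, h1, h1, not_not]
  obtain ⟨l, hl, hle⟩ := exists_submodule_ge_finrank_eq P.submodule 2
    (by rw [P.finrank_submodule]; omega) (by simp)
  exact ⟨l, hl, hle, hle, hle⟩

/-- The line through `⟨x⟩` and its image contains the orbit of `x`, which spans `π`. Any other such
line contains `x` and `σ x`, which are independent over `K`. -/
theorem IsFixedPlane.existsUnique_hISpace (hK : finrank F K = 3) (hσ : Induces σ φ)
    (hφ3 : ∀ P, φ (φ (φ P)) = P) {π : Submodule F (Fin 3 → K)} (hπ : IsFixedPlane σ π)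
    (hII : ContainsIITriPoint φ σ π) :
    ∃! T : Submodule F (Fin 3 → K), IsHISpace φ T ∧ π ≤ T := by
  have : FiniteDimensional F K := FiniteDimensional.of_finrank_pos (by omega)
  obtain ⟨x, hx, hT, hli, hxπ⟩ := (exists_triangleOrbit_iff hK _ π).1 hII
  obtain ⟨l, hl, h0, h1, h2⟩ := hσ.exists_typeILine hφ3 hx hT
  refine ⟨l.restrictScalars F, ⟨⟨l, hl, rfl⟩, ?_⟩, ?_⟩
  · rw [← span_orbit_eq hli hπ.1 hxπ (hπ.apply_mem hxπ) (hπ.apply_mem (hπ.apply_mem hxπ)),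
      Submodule.span_le]
    rintro _ ⟨i, rfl⟩
    fin_cases i <;> assumption
  · rintro _ ⟨⟨m, hm, rfl⟩, hle⟩
    have hpair := hσ.linearIndependent_pair hx hT.1
    rw [eq_span_pair hpair hl.1 h0 h1, eq_span_pair hpair hm.1 (hle hxπ) (hle (hπ.apply_mem hxπ))]

theorem IsPtwiseFixed.exists_smul_eq {π : Submodule F (Fin 3 → K)} (h : IsPtwiseFixed σ π)
    {x : Fin 3 → K} (hx : x ∈ π) : ∃ a : F, a • x = σ x := by
  by_cases hx0 : x = 0
  · exact ⟨0, by simp [hx0]⟩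
  · have := h (.mk F x hx0)
      (by rwa [Projectivization.submodule_mk, Submodule.span_singleton_le_iff_mem])
    rwa [act_mk, Projectivization.mk_eq_mk_iff'] at this

theorem IsPtwiseFixed.not_linearIndependent {π : Submodule F (Fin 3 → K)}
    (h : IsPtwiseFixed σ π) {x : Fin 3 → K} (hx : x ∈ π) :
    ¬ LinearIndependent F ![x, σ x, σ (σ x)] := by
  obtain ⟨a, ha⟩ := h.exists_smul_eq hx
  rw [Fintype.not_linearIndependent_iff]
  refine ⟨![a, -1, 0], ?_, 1, by simp⟩
  simp [Fin.sum_univ_three, ha]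

/-- On the spread plane of a fixed point `⟨x⟩`, with `σ x = d • x`, the map `σ` becomes `y ↦ d * τ
y`, which satisfies no quadratic equation. -/
theorem IsSIPlane.not_quadratic {b : Basis (Fin 3) K (Fin 3 → K)} {τ : K →ₐ[F] K} {c : K}
    (hτ : τ ≠ AlgHom.id F K) (hτ3 : ∀ x, τ (τ (τ x)) = x)
    (hb : ∀ x i, b.repr (σ x) i = c * τ (b.repr x i)) (hσ : Induces σ φ)
    {π : Submodule F (Fin 3 → K)} (h : IsSIPlane φ π) (r s : F) :
    ¬ ∀ x ∈ π, σ (σ x) = r • σ x + s • x := by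
  obtain ⟨P, hP, rfl⟩ := h
  induction P using Projectivization.ind with | _ x hx =>
  rw [IsTypeIPoint, hσ.apply_mk, Projectivization.mk_eq_mk_iff'] at hP
  obtain ⟨d, hd⟩ := hP
  have hd0 : d ≠ 0 := by
    rintro rfl
    rw [zero_smul, eq_comm, σ.map_eq_zero_iff] at hd
    exact hx hd
  intro hq
  refine no_quadratic_semilinear hτ hτ3 hd0 r s fun y ↦ ?_
  have := hq (y • x) ((mem_spreadPlane_mk hx).2 ⟨y, rfl⟩)
  simp only [map_smul_of_coordinates hb, ← hd] at this
  simp only [← algebraMap_smul K r, ← algebraMap_smul K s, smul_smul, ← add_smul] at this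
  have hcoeff := smul_left_injective K hx this
  simp only [Algebra.smul_def, map_mul]
  linear_combination hcoeff

theorem isHPlane_of_quadratic {b : Basis (Fin 3) K (Fin 3 → K)} {τ : K →ₐ[F] K} {c : K}
    (hK : finrank F K = 3) (hτ : τ ≠ AlgHom.id F K) (hτ3 : ∀ x, τ (τ (τ x)) = x) (hc : c ≠ 0)
    (hb : ∀ x i, b.repr (σ x) i = c * τ (b.repr x i)) {π : Submodule F (Fin 3 → K)}
    (hπ : IsFixedPlane σ π) (hpt : ¬ IsPtwiseFixed σ π) {r s : F}
    (hq : ∀ x ∈ π, σ (σ x) = r • σ x + s • x) : IsHPlane σ π := by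
  refine ⟨?_, hpt⟩
  rw [IsPtwiseFixed] at hpt
  push Not at hpt
  obtain ⟨X, hX, hne⟩ := hpt
  induction X using Projectivization.ind with | _ x hx =>
  rw [Projectivization.submodule_mk, Submodule.span_singleton_le_iff_mem] at hX
  have hli : LinearIndependent F ![x, σ x] := by
    rw [LinearIndependent.pair_iff' hx]
    intro a ha
    exact hne (by rw [act_mk, Projectivization.mk_eq_mk_iff']; exact ⟨a, ha⟩)
  obtain ⟨n, hn⟩ := exists_cube_eq_smul hK hτ hτ3 c
  have h3 := cube_apply_of_coordinates hb hn x
  rw [hq _ (hπ.apply_mem hX), hq _ hX] at h3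
  -- Reducing `σ ^ 3 x = n x` by the quadratic and comparing coefficients of `x` and `σ x` gives `r
  -- s = n` and `r ^ 2 + s = 0`; the eigenvalue is `a = -r`.
  obtain ⟨h1, h2⟩ := LinearIndependent.pair_iff.1 hli (r * s - n) (r ^ 2 + s) (by
    rw [← sub_eq_zero] at h3
    rw [← h3]
    module)
  have hs : s = -r ^ 2 := by linear_combination h2
  have hnr : n = (-r) ^ 3 := by linear_combination -h1 + r * h2
  rw [hnr] at hn
  refine ⟨_, isHwiseFixedSpace_ker_quadratic hK hτ hτ3 hc hb hn, fun y hy ↦ ?_⟩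
  simp only [pow_two, LinearMap.add_apply, Module.End.mul_apply, LinearMap.smul_apply,
    Module.End.one_apply, LinearMap.mem_ker, LinearEquiv.coe_coe, hq y hy, hs]
  module

end FixedPlanes

end FieldReduction

theorem theorem17 {F K : Type*} [Field F] [Finite F] [Field K] [Algebra F K]
    (hq : 2 < Nat.card F) (hK : Module.finrank F K = 3)
    (φ : Equiv.Perm (Projectivization K (Fin 3 → K)))
    (hφ : FieldReduction.IsCollineation φ) (hφ3 : orderOf φ = 3)
    (S : Set (Projectivization K (Fin 3 → K))) (hS : FieldReduction.IsSubplane F S)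
    (hfix : ∀ P ∈ S, φ P = P)
    (σ : (Fin 3 → K) ≃ₗ[F] (Fin 3 → K)) (hσ : FieldReduction.Induces σ φ)
    (π : Submodule F (Fin 3 → K)) (hπ : FieldReduction.IsFixedPlane σ π) :
    (∃! t : FieldReduction.PlaneType, FieldReduction.HasType φ σ π t) ∧
      (FieldReduction.ContainsIITriPoint φ σ π →
        ∃! T : Submodule F (Fin 3 → K), FieldReduction.IsHISpace φ T ∧ π ≤ T) := by
  open FieldReduction in
  have : FiniteDimensional F K := FiniteDimensional.of_finrank_pos (by omega)
  obtain ⟨b, rfl⟩ := hS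
  obtain ⟨τ, c, hτ, hc, hb⟩ := hσ.exists_semilinear hφ3 b hfix
  have hτ3 := algHom_cube_apply hK τ
  have hcube : ∀ P, φ (φ (φ P)) = P := fun P ↦ by
    have h : φ ^ 3 = 1 := orderOf_dvd_iff_pow_eq_one.1 hφ3.dvd
    exact DFunLike.congr_fun h P
  refine ⟨?_, hπ.existsUnique_hISpace hK hσ hcube⟩
  have hIIiff : ContainsIITriPoint φ σ π ↔ _ := exists_triangleOrbit_iff hK _ π
  have hIIIiff : ContainsIIITriPoint φ σ π ↔ _ := exists_triangleOrbit_iff hK _ π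
  rcases exists_linearIndependent_or_quadratic_of_invariant σ.toLinearMap π
    (fun x hx ↦ hπ.apply_mem hx) with ⟨x, hxπ, hli⟩ | ⟨r, s, hq⟩
  · change LinearIndependent F ![x, σ x, σ (σ x)] at hli
    have hx : x ≠ 0 := hli.ne_zero 0
    have hpt : ¬ IsPtwiseFixed σ π := fun h ↦ h.not_linearIndependent hxπ hli
    have hh : ¬ IsHPlane σ π := fun ⟨⟨U, hU, hle⟩, _⟩ ↦
      hU.not_linearIndependent hK hτ hτ3 hc hb (hle hxπ) hli
    -- Every vector of an `𝕊_I`-plane spans the same fixed point over `K`, which excludes Types II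
    -- and III.
    have hI_of : ∀ {y : Fin 3 → K} (hy : y ≠ 0), IsSIPlane φ π → y ∈ π →
        IsTypeIPoint φ (.mk K y hy) := by
      rintro y hy ⟨P, hP, rfl⟩ hyπ
      induction P using Projectivization.ind with | _ z hz =>
      rw [mem_spreadPlane_mk] at hyπ
      rwa [(Projectivization.mk_eq_mk_iff' K y z hy hz).2 hyπ]
    have hI_II : IsSIPlane φ π → ¬ ContainsIITriPoint φ σ π := by
      rw [hIIiff]
      rintro hI ⟨y, hy, hT, -, hyπ⟩
      exact hT.1 (hI_of hy hI hyπ).symm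
    have hI_III : IsSIPlane φ π → ¬ ContainsIIITriPoint φ σ π := by
      rw [hIIIiff]
      rintro hI ⟨y, hy, hT, -, hyπ⟩
      exact (hI_of hy hI hyπ).not_typeIII hT
    have hII_III : ContainsIITriPoint φ σ π → ¬ ContainsIIITriPoint φ σ π := by
      intro hII
      obtain ⟨_, ⟨⟨l, hl, rfl⟩, hle⟩, -⟩ := hπ.existsUnique_hISpace hK hσ hcube hII
      rw [hIIIiff]
      rintro ⟨y, hy, hT, -, hyπ⟩
      exact hl.not_typeIII hy (hle hyπ) hT
    rcases isTypeI_or_isTypeII_or_isTypeIII hcube (.mk K x hx) with h | h | h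
    · have hI : IsSIPlane φ π := ⟨_, h, hπ.eq_spreadPlane hK hσ hx hxπ hli h⟩
      refine ⟨.sI, hI, fun t ht ↦ ?_⟩
      cases t
      exacts [absurd ht hpt, rfl, absurd ht (hI_II hI), absurd ht (hI_III hI), absurd ht hh]
    · have hII := hIIiff.2 ⟨x, hx, h, hli, hxπ⟩
      refine ⟨.fixedII, hII, fun t ht ↦ ?_⟩
      cases t
      exacts [absurd ht hpt, absurd hII (hI_II ht), rfl, absurd ht (hII_III hII), absurd ht hh]
    · have hIII := hIIIiff.2 ⟨x, hx, h, hli, hxπ⟩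
      refine ⟨.fixedIII, hIII, fun t ht ↦ ?_⟩
      cases t
      exacts [absurd ht hpt, absurd hIII (hI_III ht), absurd hIII (hII_III ht), rfl, absurd ht hh]
  · have hq' : ∀ x ∈ π, σ (σ x) = r • σ x + s • x := hq
    have hnli : ∀ x ∈ π, ¬ LinearIndependent F ![x, σ x, σ (σ x)] := by
      intro x hx
      rw [Fintype.not_linearIndependent_iff]
      refine ⟨![s, r, -1], ?_, 2, by simp⟩
      simp only [Fin.sum_univ_three, Matrix.cons_val_zero, Matrix.cons_val_one, Matrix.cons_val,
        hq' x hx]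
      module
    have hI : ¬ IsSIPlane φ π := fun h ↦ h.not_quadratic hτ hτ3 hb hσ r s hq'
    have hII : ¬ ContainsIITriPoint φ σ π := by
      rw [hIIiff]
      rintro ⟨y, -, -, hy, hyπ⟩
      exact hnli y hyπ hy
    have hIII : ¬ ContainsIIITriPoint φ σ π := by
      rw [hIIIiff]
      rintro ⟨y, -, -, hy, hyπ⟩
      exact hnli y hyπ hy
    by_cases hpt : IsPtwiseFixed σ π
    · refine ⟨.ptwiseFixed, hpt, fun t ht ↦ ?_⟩
      cases t
      exacts [rfl, absurd ht hI, absurd ht hII, absurd ht hIII, absurd hpt ht.2]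
    · refine ⟨.h, isHPlane_of_quadratic hK hτ hτ3 hc hb hπ hpt hq', fun t ht ↦ ?_⟩
      cases t
      exacts [absurd ht hpt, absurd ht hI, absurd ht hII, absurd ht hIII, rfl]
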